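/- Let $k$ be an algebraically closed field of characteristic $p>0$ and let $G$ be a connected smooth linear algebraic group over $k$ with Lie algebra $\mathfrak g$. Let $\mathcal N_p(\mathfrak g)$ be the variety of $B\in\mathfrak g$ with $B^{[p]}=0$, let $\mathcal C_r(\mathcal N_p(\mathfrak g))$ be the variety of $r$-tuples of pairwise commuting elements of $\mathcal N_p(\mathfrak g)$, and let $V_r(G)$ be the variety of homomorphisms $\mathbb G_{a(r)}\to G$, where $i_r:\mathbb G_{a(r)}\subset\mathbb G_a$ is the $r$-th Frobenius kernel. Let $F$ be the Frobenius of $\mathbb G_a$. Suppose that $G$ is of exponential type, i.e. that there is a morphism $\mathcal E:\mathcal N_p(\mathfrak g)\times\mathbb G_a\to G$, $(B,s)\mapsto\mathcal E_B(s)$, such that (1) each $\mathcal E_B:\mathbb G_a\to G$ is a homomorphism; (2) $\mathcal E_B$ and $\mathcal E_{B'}$ commute if $[B,B']=0$; (3) $\mathcal E_{\alpha B}(s)=\mathcal E_B(\alpha s)$ for all $\alpha,s$ in any commutative $k$-algebra; (4) every homomorphism $\mathbb G_a\to G$ is of the form $\mathcal E_{\underline B}=\prod_{s=0}^{r-1}\mathcal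 E_{B_s}\circ F^s$ with $r>0$ and $\underline B\in\mathcal C_r(\mathcal N_p(\mathfrak g))$, and for each $r>0$ the map $\mathcal C_r(\mathcal N_p(\mathfrak g))\to V_r(G)$, $\underline B\mapsto\mathcal E_{\underline B}\circ i_r$, is an isomorphism. Fix such an $\mathcal E$. For $d\ge 0$ let $(k[G])_{[d]}$ be the largest subcoalgebra of $k[G]$ contained in the space of those $f\in k[G]$ such that $\mathcal E_B^*(f)\in k[\mathbb G_a]=k[T]$ has degree at most $d$ for all $B\in\mathcal N_p(\mathfrak g)$. For a rational $G$-module $M$ with coaction $\Delta_M:M\to M\otimes k[G]$ put $M_{[d]}=\{m\in M:\Delta_M(m)\in M\otimes(k[G])_{[d]}\}$; this defines a functor $(-)_{[d]}$ from rational $G$-modules to right $(k[G])_{[d]}$-comodules. Let $H^0(G,M)=\{m\in M:\Delta_M(m)=m\otimes1\}$ and let $H^n(G,-)$ be the $n$-th right derived functor of $H^0(G,-)$. Then for every $d\ge0$ there is an isomorphism of functors from rational $G$-modules to $k$-vector spaces $$\mathrm{Hom}_{(k[G])_{[d]}\text{-coMod}}(k,-)\circ(-)_{[d]}\;\simeq\;H^0(G,-),\qquad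 \varphi\mapsto\varphi(1),$$ and for every rational $G$-module $M$ there is a convergent first quadrant cohomological spectral sequence $$E_2^{s,t}=\big(R^s\mathrm{Hom}_{(k[G])_{[d]}\text{-coMod}}(k,-)\circ R^t(-)_{[d]}\big)(M)\;\Rightarrow\;H^{s+t}(G,M).$$ -/

import Mathlib

open CategoryTheory TensorProduct Polynomial

universe u

namespace ExpFiltration

noncomputable section

section Comodules

variable (k : Type u) [Field k] (C : Type u) [AddCommGroup C] [Module k C] [Coalgebra k C]

/-- The comonad `M ↦ M ⊗ C` on `k`-vector spaces attached to a `k`-coalgebra `C`. -/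
def tensorComonad : Comonad (ModuleCat.{u} k) where
  obj M := ModuleCat.of k (M ⊗[k] C)
  map f := ModuleCat.ofHom (f.hom.rTensor C)
  map_id M := by ext : 1; exact LinearMap.rTensor_id C M
  map_comp f g := by ext : 1; exact LinearMap.rTensor_comp C g.hom f.hom
  ε :=
    { app M := ModuleCat.ofHom
        ((TensorProduct.rid k M).toLinearMap ∘ₗ (Coalgebra.counit (R := k) (A := C)).lTensor M)
      naturality M N f := by
        ext : 1
        refine TensorProduct.ext' fun m c => ?_
        simp }
  δ :=
    { app M := ModuleCat.ofHom
        ((TensorProduct.assoc k M C C).symm.toLinearMap ∘ₗ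
          (Coalgebra.comul (R := k) (A := C)).lTensor M)
      naturality M N f := by
        ext : 1
        refine TensorProduct.ext' fun m c => ?_
        simp
        induction Coalgebra.comul (R := k) c using TensorProduct.induction_on with
        | zero => simp
        | tmul x y => simp
        | add x y hx hy => simp only [TensorProduct.tmul_add, map_add, hx, hy] }
  coassoc M := by
    ext : 1
    refine TensorProduct.ext' fun m c => ?_
    simp
    let Φ := (TensorProduct.assoc k (M ⊗[k] C) C C).symm.toLinearMap ∘ₗ
      (TensorProduct.mk k M C m).rTensor (C ⊗[k] C)
    have h₁ (x : C ⊗[k] C) :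
        ((TensorProduct.assoc k M C C).symm.toLinearMap ∘ₗ
          (Coalgebra.comul (R := k) (A := C)).lTensor M).rTensor C
          ((TensorProduct.assoc k M C C).symm (m ⊗ₜ[k] x)) =
        Φ (TensorProduct.assoc k C C C ((Coalgebra.comul (R := k)).rTensor C x)) := by
      induction x using TensorProduct.induction_on with
      | zero => simp
      | add x y hx hy => simp only [TensorProduct.tmul_add, map_add, hx, hy]
      | tmul x y =>
        simp [Φ]
        induction Coalgebra.comul (R := k) x using TensorProduct.induction_on with
        | zero => simp
        | tmul z w => simp
        | add x y hx hy => simp only [TensorProduct.tmul_add, TensorProduct.add_tmul, map_add, hx, hy]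
    have h₂ (x : C ⊗[k] C) :
        (TensorProduct.assoc k (M ⊗[k] C) C C).symm
          ((Coalgebra.comul (R := k) (A := C)).lTensor (M ⊗[k] C)
            ((TensorProduct.assoc k M C C).symm (m ⊗ₜ[k] x))) =
        Φ ((Coalgebra.comul (R := k)).lTensor C x) := by
      induction x using TensorProduct.induction_on with
      | zero => simp
      | add x y hx hy => simp only [TensorProduct.tmul_add, map_add, hx, hy]
      | tmul x y => simp [Φ]
    rw [h₁, h₂, Coalgebra.coassoc_apply]
  left_counit M := by
    ext : 1
    refine TensorProduct.ext' fun m c => ?_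
    simp
    have h (x : C ⊗[k] C) :
        TensorProduct.rid k (M ⊗[k] C)
          ((Coalgebra.counit (R := k) (A := C)).lTensor (M ⊗[k] C)
            ((TensorProduct.assoc k M C C).symm (m ⊗ₜ[k] x))) =
        m ⊗ₜ[k] TensorProduct.rid k C ((Coalgebra.counit (R := k)).lTensor C x) := by
      induction x using TensorProduct.induction_on with
      | zero => simp
      | add x y hx hy => simp only [TensorProduct.tmul_add, map_add, hx, hy]
      | tmul x y => simp
    rw [h]
    simp
  right_counit M := by
    ext : 1
    refine TensorProduct.ext' fun m c => ?_
    simp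
    have h (x : C ⊗[k] C) :
        ((TensorProduct.rid k M).toLinearMap ∘ₗ
          (Coalgebra.counit (R := k) (A := C)).lTensor M).rTensor C
            ((TensorProduct.assoc k M C C).symm (m ⊗ₜ[k] x)) =
        m ⊗ₜ[k] TensorProduct.lid k C ((Coalgebra.counit (R := k)).rTensor C x) := by
      induction x using TensorProduct.induction_on with
      | zero => simp
      | add x y hx hy => simp only [TensorProduct.tmul_add, map_add, hx, hy]
      | tmul x y => simp [TensorProduct.smul_tmul']
    rw [h]
    simp

/-- The category of right `C`-comodules: vector spaces `M` with a counital and coassociative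
coaction `M → M ⊗ C`. For `C = k[G]` this is the category of rational `G`-modules. -/
abbrev Comod := (tensorComonad k C).Coalgebra

instance : (tensorComonad k C).toFunctor.Additive where
  map_add {M N f g} := by
    ext : 1
    exact LinearMap.rTensor_add C f.hom g.hom

open Limits in
instance : PreservesFiniteLimits (tensorComonad k C).toFunctor :=
  preservesFiniteLimits_of_natIso (NatIso.ofComponents (fun _ => Iso.refl _) :
    MonoidalCategory.tensorRight (ModuleCat.of k C) ≅ (tensorComonad k C).toFunctor)

instance : Linear k (Comod k C) where
  homModule M N :=
    { smul a f :=
        { f := a • f.f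
          h := by
            have e : (tensorComonad k C).map (a • f.f) = a • (tensorComonad k C).map f.f := by
              ext : 1
              exact LinearMap.rTensor_smul C a f.f.hom
            rw [e, Linear.comp_smul, Linear.smul_comp, f.h] }
      one_smul f := by
        ext : 1
        exact one_smul k f.f
      mul_smul a b f := by
        ext : 1
        exact mul_smul a b f.f
      smul_zero a := by
        ext : 1
        exact smul_zero (A := M.A ⟶ N.A) a
      zero_smul f := by
        ext : 1
        exact zero_smul k f.f
      smul_add a f g := by
        ext : 1
        exact smul_add a f.f g.f
      add_smul a b f := by
        ext : 1
        exact add_smul a b f.f }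
  smul_comp M N P a f g := by
    ext : 1
    exact Linear.smul_comp M.A N.A P.A a f.f g.f
  comp_smul M N P f a g := by
    ext : 1
    exact Linear.comp_smul M.A N.A P.A f.f a g.f

open Limits

instance : HasFiniteLimits (Comod k C) :=
  ⟨fun _ _ _ => hasLimitsOfShape_of_hasLimitsOfShape_createsLimitsOfShape (tensorComonad k C).forget⟩

instance : HasFiniteColimits (Comod k C) :=
  ⟨fun _ _ _ => hasColimitsOfShape_of_hasColimitsOfShape_createsColimitsOfShape (tensorComonad k C).forget⟩

instance : PreservesFiniteLimits (tensorComonad k C).forget := ⟨fun _ _ _ => inferInstance⟩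

instance : PreservesFiniteColimits (tensorComonad k C).forget := ⟨fun _ _ _ => inferInstance⟩

instance : Abelian (Comod k C) := by
  have (M N : Comod k C) (f : M ⟶ N) : IsIso (Abelian.coimageImageComparison f) := by
    have : IsIso ((tensorComonad k C).forget.map (Abelian.coimageImageComparison f)) := by
      have h := Abelian.PreservesCoimage.hom_coimageImageComparison (tensorComonad k C).forget f
      have h' : IsIso ((tensorComonad k C).forget.map (Abelian.coimageImageComparison f) ≫
          (Abelian.PreservesImage.iso (tensorComonad k C).forget f).hom) := by
        rw [← h]
        infer_instance
      exact IsIso.of_isIso_comp_right _ (Abelian.PreservesImage.iso (tensorComonad k C).forget f).hom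
    exact isIso_of_reflects_iso _ (tensorComonad k C).forget
  exact Abelian.ofCoimageImageComparisonIsIso

instance : EnoughInjectives (Comod k C) :=
  EnoughInjectives.of_adjunction (tensorComonad k C).adj

variable {k C}

/-- The coaction `M → M ⊗ C` of a comodule. -/
def Comod.coaction (M : Comod k C) : M.A →ₗ[k] M.A ⊗[k] C := M.a.hom

lemma Comod.counit_apply (M : Comod k C) (m : M.A) :
    TensorProduct.rid k M.A (Coalgebra.counit.lTensor M.A (M.coaction m)) = m :=
  LinearMap.congr_fun (congrArg ModuleCat.Hom.hom M.counit) m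

lemma Comod.coassoc_apply (M : Comod k C) (m : M.A) :
    TensorProduct.assoc k M.A C C (M.coaction.rTensor C (M.coaction m)) =
      Coalgebra.comul.lTensor M.A (M.coaction m) := by
  rw [← LinearEquiv.eq_symm_apply]
  exact (LinearMap.congr_fun (congrArg ModuleCat.Hom.hom M.coassoc) m).symm

lemma Comod.coaction_hom {M N : Comod k C} (f : M ⟶ N) (m : M.A) :
    N.coaction (f.f.hom m) = f.f.hom.rTensor C (M.coaction m) :=
  (LinearMap.congr_fun (congrArg ModuleCat.Hom.hom f.h) m).symm

/-- Construct a comodule from a vector space `V` with a counital and coassociative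
coaction `V → V ⊗ C`. -/
def Comod.ofCoaction {V : Type u} [AddCommGroup V] [Module k V] (ρ : V →ₗ[k] V ⊗[k] C)
    (counit : (TensorProduct.rid k V).toLinearMap ∘ₗ Coalgebra.counit.lTensor V ∘ₗ ρ = .id)
    (coassoc : (TensorProduct.assoc k V C C).toLinearMap ∘ₗ ρ.rTensor C ∘ₗ ρ =
      Coalgebra.comul.lTensor V ∘ₗ ρ) : Comod k C where
  A := ModuleCat.of k V
  a := ModuleCat.ofHom ρ
  counit := by
    ext : 1
    exact counit
  coassoc := by
    ext : 1
    have h := congrArg (fun f => (TensorProduct.assoc k V C C).symm.toLinearMap ∘ₗ f) coassoc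
    refine Eq.trans ?_ (h.symm.trans ?_)
    · rfl
    · ext v
      simp [tensorComonad]

/-- The one-dimensional comodule `k` with coaction `1 ↦ 1 ⊗ g` attached to a group-like `g`. -/
def trivialComod (g : C) (hg : IsGroupLikeElem k g) : Comod k C :=
  Comod.ofCoaction (V := k) ((TensorProduct.mk k k C).flip g)
    (by ext; simp [hg.counit_eq_one])
    (by ext; simp [hg.comul_eq_tmul_self])

end Comodules

section Subcoalgebras

variable (k : Type u) [Field k] (C : Type u) [AddCommGroup C] [Module k C] [Coalgebra k C]

/-- A subcoalgebra: a subspace `S ⊆ C` such that `Δ(S) ⊆ S ⊗ S`. -/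
structure Subcoalgebra where
  carrier : Submodule k C
  comul_mem (c : C) : c ∈ carrier →
    Coalgebra.comul c ∈ LinearMap.range (TensorProduct.map carrier.subtype carrier.subtype)

variable {k C}

lemma map_subtype_injective {V W : Type u} [AddCommGroup V] [Module k V] [AddCommGroup W]
    [Module k W] (S : Submodule k V) (T : Submodule k W) :
    Function.Injective (TensorProduct.map S.subtype T.subtype) :=
  TensorProduct.map_injective_of_flat_flat _ _ S.subtype_injective T.subtype_injective

namespace Subcoalgebra

/-- The largest subcoalgebra contained in a subspace `W`: the sum of all subcoalgebras
contained in `W`. -/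
def largest (W : Submodule k C) : Subcoalgebra k C where
  carrier := ⨆ S : {S : Subcoalgebra k C // S.carrier ≤ W}, S.1.carrier
  comul_mem c hc := by
    induction hc using Submodule.iSup_induction' with
    | zero => simp
    | add x y _ _ hx hy => rw [map_add]; exact add_mem hx hy
    | mem S x hx =>
      obtain ⟨y, hy⟩ := S.1.comul_mem x hx
      have hle := le_iSup (fun S : {S : Subcoalgebra k C // S.carrier ≤ W} => S.1.carrier) S
      refine ⟨TensorProduct.map (Submodule.inclusion hle) (Submodule.inclusion hle) y, ?_⟩
      rw [← hy, ← LinearMap.comp_apply, ← TensorProduct.map_comp]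
      rfl

lemma largest_le (W : Submodule k C) : (largest W).carrier ≤ W :=
  iSup_le fun S => S.2

lemma le_largest (W : Submodule k C) (S : Subcoalgebra k C) (h : S.carrier ≤ W) :
    S.carrier ≤ (largest W).carrier :=
  le_iSup (fun S : {S : Subcoalgebra k C // S.carrier ≤ W} => S.1.carrier) ⟨S, h⟩

variable (S : Subcoalgebra k C)

/-- The comultiplication of `C` restricted to a subcoalgebra. -/
def comul : S.carrier →ₗ[k] S.carrier ⊗[k] S.carrier :=
  LinearMap.codRestrictOfInjective (Coalgebra.comul ∘ₗ S.carrier.subtype)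
    (TensorProduct.map S.carrier.subtype S.carrier.subtype) (map_subtype_injective _ _)
    fun c => S.comul_mem c c.2

lemma map_comul (c : S.carrier) :
    TensorProduct.map S.carrier.subtype S.carrier.subtype (S.comul c) =
      Coalgebra.comul (R := k) (c : C) :=
  LinearMap.codRestrictOfInjective_comp_apply _ _ _ _ _

lemma map_assoc {V V' W W' X X' : Type u} [AddCommGroup V] [Module k V] [AddCommGroup V']
    [Module k V'] [AddCommGroup W] [Module k W] [AddCommGroup W'] [Module k W'] [AddCommGroup X]
    [Module k X] [AddCommGroup X'] [Module k X'] (f : V →ₗ[k] V') (g : W →ₗ[k] W')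
    (h : X →ₗ[k] X') (x : (V ⊗[k] W) ⊗[k] X) :
    TensorProduct.map f (TensorProduct.map g h) (TensorProduct.assoc k V W X x) =
      TensorProduct.assoc k V' W' X' (TensorProduct.map (TensorProduct.map f g) h x) := by
  refine LinearMap.congr_fun (f := TensorProduct.map f (TensorProduct.map g h) ∘ₗ
    (TensorProduct.assoc k V W X).toLinearMap) (g := (TensorProduct.assoc k V' W' X').toLinearMap ∘ₗ
      TensorProduct.map (TensorProduct.map f g) h) ?_ x
  ext
  simp

instance : Coalgebra k S.carrier where
  comul := S.comul
  counit := Coalgebra.counit ∘ₗ S.carrier.subtype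
  coassoc := by
    ext c
    apply TensorProduct.map_injective_of_flat_flat _ _ S.carrier.subtype_injective
      (map_subtype_injective S.carrier S.carrier)
    have h : TensorProduct.map S.carrier.subtype S.carrier.subtype ∘ₗ S.comul =
        Coalgebra.comul (R := k) ∘ₗ S.carrier.subtype := by
      ext c
      exact S.map_comul c
    simp only [LinearMap.comp_apply, LinearEquiv.coe_coe, map_assoc]
    rw [← LinearMap.comp_apply (TensorProduct.map _ _) (S.comul.rTensor _),
      ← LinearMap.comp_apply (TensorProduct.map _ _) (S.comul.lTensor _),
      LinearMap.map_comp_rTensor, LinearMap.map_comp_lTensor, h, ← LinearMap.rTensor_comp_map,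
      ← LinearMap.lTensor_comp_map, LinearMap.comp_apply, LinearMap.comp_apply, S.map_comul,
      Coalgebra.coassoc_apply]
  rTensor_counit_comp_comul := by
    ext c
    apply Module.Flat.lTensor_preserves_injective_linearMap (M := k) _ S.carrier.subtype_injective
    have h := Coalgebra.rTensor_counit_comul (R := k) (c : C)
    rw [← S.map_comul, ← LinearMap.comp_apply, LinearMap.rTensor_comp_map] at h
    rw [LinearMap.comp_apply, ← LinearMap.comp_apply (LinearMap.lTensor _ _),
      LinearMap.lTensor_comp_rTensor]
    exact h
  lTensor_counit_comp_comul := by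
    ext c
    apply Module.Flat.rTensor_preserves_injective_linearMap (M := k) _ S.carrier.subtype_injective
    have h := Coalgebra.lTensor_counit_comul (R := k) (c : C)
    rw [← S.map_comul, ← LinearMap.comp_apply, LinearMap.lTensor_comp_map] at h
    rw [LinearMap.comp_apply, ← LinearMap.comp_apply (LinearMap.rTensor _ _),
      LinearMap.rTensor_comp_lTensor]
    exact h

/-- For a comodule `M` over `C`, the subspace of those `m` with `Δ_M(m) ∈ M ⊗ S`. -/
def restrictSubmodule (M : Comod k C) : Submodule k M.A :=
  (LinearMap.range (S.carrier.subtype.lTensor M.A)).comap M.coaction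

lemma coaction_mem (M : Comod k C) (m : M.A) (hm : m ∈ S.restrictSubmodule M) :
    M.coaction m ∈ LinearMap.range
      (TensorProduct.map (S.restrictSubmodule M).subtype S.carrier.subtype) := by
  obtain ⟨y, hy⟩ := hm
  let q := S.carrier.mkQ
  let θ := q.lTensor M.A ∘ₗ M.coaction
  have hex : Function.Exact (S.restrictSubmodule M).subtype θ := by
    intro x
    have h := lTensor_exact M.A (LinearMap.exact_subtype_mkQ S.carrier) S.carrier.mkQ_surjective
      (M.coaction x)
    rw [LinearMap.comp_apply, h, Submodule.coe_subtype, Subtype.range_coe]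
    rfl
  have hz : θ.rTensor S.carrier y = 0 := by
    apply Module.Flat.lTensor_preserves_injective_linearMap (M := M.A ⊗[k] (C ⧸ S.carrier)) _
      S.carrier.subtype_injective
    rw [← LinearMap.comp_apply, LinearMap.lTensor_comp_rTensor, ← LinearMap.rTensor_comp_lTensor,
      LinearMap.comp_apply, hy, LinearMap.rTensor_comp, LinearMap.comp_apply, map_zero]
    have h := Comod.coassoc_apply M m
    rw [← LinearEquiv.eq_symm_apply] at h
    rw [h, ← hy]
    have h' (y : M.A ⊗[k] S.carrier) : (q.lTensor M.A).rTensor C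
        ((TensorProduct.assoc k M.A C C).symm
          (Coalgebra.comul.lTensor M.A (S.carrier.subtype.lTensor M.A y))) = 0 := by
      induction y using TensorProduct.induction_on with
      | zero => simp
      | add x y hx hy => simp only [map_add, hx, hy, add_zero]
      | tmul x c =>
        simp only [LinearMap.lTensor_tmul, Submodule.subtype_apply]
        rw [← S.map_comul]
        induction S.comul c using TensorProduct.induction_on with
        | zero => simp
        | add x y hx hy => simp only [map_add, TensorProduct.tmul_add, hx, hy, add_zero]
        | tmul a b => simp [q, (Submodule.Quotient.mk_eq_zero S.carrier).2 a.2]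
    exact h' y
  obtain ⟨w, hw⟩ := (Module.Flat.rTensor_exact S.carrier hex y).1 hz
  refine ⟨w, ?_⟩
  rw [← hy, ← hw, ← LinearMap.comp_apply, LinearMap.lTensor_comp_rTensor]

/-- The coaction of `C` on `M` restricts to a coaction of the subcoalgebra `S` on
the subspace of those `m` with `Δ_M(m) ∈ M ⊗ S`. -/
def restrictCoaction (M : Comod k C) :
    S.restrictSubmodule M →ₗ[k] S.restrictSubmodule M ⊗[k] S.carrier :=
  LinearMap.codRestrictOfInjective (M.coaction ∘ₗ (S.restrictSubmodule M).subtype)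
    (TensorProduct.map (S.restrictSubmodule M).subtype S.carrier.subtype)
    (map_subtype_injective _ _) fun m => S.coaction_mem M m m.2

lemma map_restrictCoaction (M : Comod k C) (m : S.restrictSubmodule M) :
    TensorProduct.map (S.restrictSubmodule M).subtype S.carrier.subtype (S.restrictCoaction M m) =
      M.coaction (m : M.A) :=
  LinearMap.codRestrictOfInjective_comp_apply _ _ _ _ _

lemma map_mem (M N : Comod k C) (f : M ⟶ N) (m : M.A) (hm : m ∈ S.restrictSubmodule M) :
    f.f.hom m ∈ S.restrictSubmodule N := by
  obtain ⟨y, hy⟩ := hm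
  refine ⟨f.f.hom.rTensor S.carrier y, ?_⟩
  rw [Comod.coaction_hom, ← hy, ← LinearMap.comp_apply, ← LinearMap.comp_apply,
    LinearMap.lTensor_comp_rTensor, LinearMap.rTensor_comp_lTensor]

lemma restrict_counit (M : Comod k C) :
    (TensorProduct.rid k (S.restrictSubmodule M)).toLinearMap ∘ₗ
      (Coalgebra.counit (R := k) (A := S.carrier)).lTensor (S.restrictSubmodule M) ∘ₗ
        S.restrictCoaction M = .id := by
  ext m
  have h := Comod.counit_apply M m
  rw [← S.map_restrictCoaction] at h
  refine Eq.trans ?_ h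
  have h' (x : S.restrictSubmodule M ⊗[k] S.carrier) :
      ((TensorProduct.rid k (S.restrictSubmodule M)
        ((Coalgebra.counit (R := k) (A := S.carrier)).lTensor (S.restrictSubmodule M) x)) : M.A) =
      TensorProduct.rid k M.A ((Coalgebra.counit (R := k) (A := C)).lTensor M.A
        (TensorProduct.map (S.restrictSubmodule M).subtype S.carrier.subtype x)) := by
    induction x using TensorProduct.induction_on with
    | zero => simp
    | add x y hx hy => simp only [map_add, Submodule.coe_add, hx, hy]
    | tmul a b => simp; rfl
  exact h' _

lemma restrict_coassoc (M : Comod k C) :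
    (TensorProduct.assoc k (S.restrictSubmodule M) S.carrier S.carrier).toLinearMap ∘ₗ
      (S.restrictCoaction M).rTensor S.carrier ∘ₗ S.restrictCoaction M =
      (Coalgebra.comul (R := k) (A := S.carrier)).lTensor (S.restrictSubmodule M) ∘ₗ
        S.restrictCoaction M := by
  ext m
  apply TensorProduct.map_injective_of_flat_flat _ _ (S.restrictSubmodule M).subtype_injective
      (map_subtype_injective S.carrier S.carrier)
  have h : TensorProduct.map S.carrier.subtype S.carrier.subtype ∘ₗ Coalgebra.comul (R := k) =
      Coalgebra.comul (R := k) ∘ₗ S.carrier.subtype := by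
    ext c
    exact S.map_comul c
  have h' : TensorProduct.map (S.restrictSubmodule M).subtype S.carrier.subtype ∘ₗ
      S.restrictCoaction M = M.coaction ∘ₗ (S.restrictSubmodule M).subtype := by
    ext c
    exact S.map_restrictCoaction M c
  simp only [LinearMap.comp_apply, LinearEquiv.coe_coe, map_assoc]
  rw [← LinearMap.comp_apply (TensorProduct.map _ _) ((S.restrictCoaction M).rTensor _),
    ← LinearMap.comp_apply (TensorProduct.map _ _) (Coalgebra.comul.lTensor _),
    LinearMap.map_comp_rTensor, LinearMap.map_comp_lTensor, h, h', ← LinearMap.rTensor_comp_map,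
    ← LinearMap.lTensor_comp_map, LinearMap.comp_apply, LinearMap.comp_apply,
    S.map_restrictCoaction, Comod.coassoc_apply]

/-- The functor sending a `C`-comodule `M` to the `S`-comodule `{m | Δ_M(m) ∈ M ⊗ S}`. -/
def restrict : Comod k C ⥤ Comod k S.carrier where
  obj M := Comod.ofCoaction (S.restrictCoaction M) (S.restrict_counit M) (S.restrict_coassoc M)
  map {M N} f :=
    { f := ModuleCat.ofHom (f.f.hom.restrict (S.map_mem M N f))
      h := by
        ext m
        apply map_subtype_injective (S.restrictSubmodule N) S.carrier
        refine Eq.trans ?_ (S.map_restrictCoaction N _).symm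
        refine Eq.trans ?_ (Comod.coaction_hom f m.1).symm
        rw [← S.map_restrictCoaction M m]
        have h : TensorProduct.map (S.restrictSubmodule N).subtype S.carrier.subtype ∘ₗ
            LinearMap.rTensor S.carrier (f.f.hom.restrict (S.map_mem M N f)) =
            LinearMap.rTensor C f.f.hom ∘ₗ
              TensorProduct.map (S.restrictSubmodule M).subtype S.carrier.subtype := by
          rw [LinearMap.map_comp_rTensor, LinearMap.rTensor_comp_map]
          rfl
        exact LinearMap.congr_fun h (S.restrictCoaction M m) }

instance : S.restrict.Additive where

/-- The inclusion of `{m | Δ_M(m) ∈ M ⊗ S}` into `M`. -/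
def restrictInclusion (M : Comod k C) : (S.restrict.obj M).A →ₗ[k] M.A :=
  (S.restrictSubmodule M).subtype

end Subcoalgebra

end Subcoalgebras

/-- The functor `M ↦ {m | Δ_M(m) = m ⊗ g}` from `C`-comodules to `k`-vector spaces. -/
def invariants {k : Type u} [Field k] {C : Type u} [AddCommGroup C] [Module k C] [Coalgebra k C]
    (g : C) : Comod k C ⥤ ModuleCat.{u} k where
  obj M := ModuleCat.of k
    (LinearMap.eqLocus M.coaction ((TensorProduct.mk k M.A C).flip g))
  map {M N} f := ModuleCat.ofHom (f.f.hom.restrict fun m hm => by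
    simp only [LinearMap.mem_eqLocus, LinearMap.flip_apply, TensorProduct.mk_apply] at hm ⊢
    rw [Comod.coaction_hom, hm, LinearMap.rTensor_tmul])

instance {k : Type u} [Field k] {C : Type u} [AddCommGroup C] [Module k C] [Coalgebra k C]
    (g : C) : (invariants (k := k) g).Additive where

/-- The inclusion of `{m | Δ_M(m) = m ⊗ g}` into `M`. -/
def invariantsInclusion {k : Type u} [Field k] {C : Type u} [AddCommGroup C] [Module k C]
    [Coalgebra k C] (g : C) (M : Comod k C) : (invariants (k := k) g).obj M →ₗ[k] M.A :=
  Submodule.subtype _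
section ExponentialType

variable (k : Type u) [Field k] (p : ℕ) (A : Type u) [CommRing A] [HopfAlgebra k A]

/-- The subset `𝒩_p(𝔤)` of `p`-nilpotent elements of the Lie algebra `𝔤` of `G = Spec A`.

Here `𝔤` is the space of point derivations `D : A → k` at the identity. It lies in the algebra
`A^* = WithConv (A →ₗ[k] k)` of linear functionals with the convolution product; its
bracket is the commutator of `A^*`, and `D^{[p]}` is the `p`-th power in `A^*`. -/
def pNilpotents : Set (WithConv (A →ₗ[k] k)) :=
  {D | (∀ f g : A, D (f * g) = Coalgebra.counit f * D g + D f * Coalgebra.counit g) ∧ D ^ p = 0}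

/-- The set `𝒞_r(𝒩_p(𝔤))` of `r`-tuples of pairwise commuting `p`-nilpotent elements. -/
def commutingTuples (r : ℕ) : Set (Fin r → pNilpotents k p A) :=
  {B | ∀ i j, Commute (B i).1 (B j).1}

variable {k} in
/-- The algebra of functions on a set `X` that are polynomials in given coordinate functions
`x i : X → k`. For a closed subset `X` of an affine space this is the coordinate algebra of the
(reduced) variety `X`. -/
def polynomialFunctions {X ι : Type*} (x : ι → X → k) : Subalgebra k (X → k) :=
  Algebra.adjoin k (Set.range x)

/-- The coordinate algebra `k[𝒩_p(𝔤)]`. Every linear functional on `𝔤` is of the form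
`D ↦ D f` with `f ∈ A`. -/
abbrev pNilpotentFunctions : Subalgebra k (pNilpotents k p A → k) :=
  polynomialFunctions fun (f : A) (B : pNilpotents k p A) => B.1 f

/-- The coordinate algebra of the variety `𝒞_r(𝒩_p(𝔤)) ⊆ 𝔤^r`. -/
def commutingFunctions (r : ℕ) : Subalgebra k (commutingTuples k p A r → k) :=
  polynomialFunctions fun (x : Fin r × A) (B : commutingTuples k p A r) =>
    (B.1 x.1).1 x.2

variable {k A} in
/-- Let `H = k[t]` or `H = k[t]/(t^N)`, the coordinate algebra of `𝔾_a` or of the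
subscheme `t^N = 0` of `𝔾_a`.
The morphism `Spec H → G` given by `φ : A → H` is a homomorphism of group schemes:
for all `k`-algebras `R` and all `R`-points `a, b, c` of `Spec H` with
`t(c) = t(a) + t(b)` we have `φ(c) = φ(a) φ(b)` in the group `G(R)`. -/
def IsAdditiveHom {H : Type u} [CommRing H] [Algebra k H] (t : H) (φ : A →ₐ[k] H) : Prop :=
  ∀ (R : Type u) [CommRing R] [Algebra k R] (a b c : H →ₐ[k] R), c t = a t + b t →
    WithConv.toConv (c.comp φ) = WithConv.toConv (a.comp φ) * WithConv.toConv (b.comp φ)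

/-- The set `V_r(G)` of infinitesimal one-parameter subgroups `𝔾_{a(r)} → G` of height `r`, where
`𝔾_{a(r)} = Spec k[t]/(t^{p^r})`. -/
def infinitesimalOnePS (r : ℕ) : Set (A →ₐ[k] AdjoinRoot (X ^ p ^ r : k[X])) :=
  {φ | IsAdditiveHom (AdjoinRoot.root (X ^ p ^ r : k[X])) φ}

/-- The coordinate algebra of the variety `V_r(G)`: its coordinate functions send `φ` to the
coefficients of the truncated polynomials `φ f`, for `f ∈ A`. -/
def infinitesimalOnePSFunctions (r : ℕ) : Subalgebra k (infinitesimalOnePS k p A r → k) :=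
  polynomialFunctions fun (x : A × ℕ) (φ : infinitesimalOnePS k p A r) =>
    (AdjoinRoot.modByMonicHom (monic_X_pow (R := k) (p ^ r)) (φ.1 x.1)).coeff x.2

section Morphism

variable {k p A}

/-- The `R`-point `ℰ_b(s)` of `G`, for a morphism `ℰ : 𝒩_p(𝔤) × 𝔾_a → G` given by
a map `A → k[𝒩_p(𝔤)][T]`, an `R`-point `b` of `𝒩_p(𝔤)` and `s ∈ 𝔾_a(R) = R`. -/
def expPoint (E : A →ₐ[k] (pNilpotentFunctions k p A)[X]) {R : Type u} [CommRing R] [Algebra k R]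
    (b : pNilpotentFunctions k p A →ₐ[k] R) (s : R) : A →ₐ[k] R :=
  (Polynomial.eval₂AlgHom b s fun _ => Commute.all _ _).comp E

/-- The comorphism `ℰ_B^* : A → k[T]` of `ℰ_B : 𝔾_a → G`, for `B ∈ 𝒩_p(𝔤)`. -/
def expAt (E : A →ₐ[k] (pNilpotentFunctions k p A)[X]) (B : pNilpotents k p A) : A →ₐ[k] k[X] :=
  (Polynomial.mapAlgHom
    ((Pi.evalAlgHom k (fun _ => k) B).comp (pNilpotentFunctions k p A).val)).comp E

/-- The comorphism `A → k[T]` of the product of the `ℰ_{B_s} ∘ F^s`, `0 ≤ s < r`, in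
the group `G(k[T])`, where `F : 𝔾_a → 𝔾_a` is the Frobenius `T ↦ T^p`. -/
def expTuple (E : A →ₐ[k] (pNilpotentFunctions k p A)[X]) {r : ℕ}
    (B : Fin r → pNilpotents k p A) : A →ₐ[k] k[X] :=
  (List.ofFn fun s : Fin r =>
    WithConv.toConv ((Polynomial.expand k (p ^ (s : ℕ))).comp (expAt E (B s)))).prod.ofConv

end Morphism

/-- A structure of exponential type on `G = Spec A`: a morphism
`ℰ : 𝒩_p(𝔤) × 𝔾_a → G`, `(B, s) ↦ ℰ_B(s)` with the following properties. -/
structure ExponentialStructure where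
  /-- the comorphism of `ℰ` -/
  map : A →ₐ[k] (pNilpotentFunctions k p A)[X]
  /-- each `ℰ_B` is a one-parameter subgroup -/
  isAdditiveHom (B : pNilpotents k p A) : IsAdditiveHom (X : k[X]) (expAt map B)
  /-- if `B` and `B'` commute, so do the one-parameter subgroups `ℰ_B` and `ℰ_{B'}` -/
  commute (B B' : pNilpotents k p A) : Commute B.1 B'.1 →
    ∀ (R : Type u) [CommRing R] [Algebra k R] (s s' : k[X] →ₐ[k] R),
      Commute (WithConv.toConv (s.comp (expAt map B))) (WithConv.toConv (s'.comp (expAt map B')))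
  /-- `ℰ_{α B}(s) = ℰ_B(α s)` for all `α, s ∈ R` and `R`-points `b` of `𝒩_p(𝔤)`; `b'` is the
  `R`-point `α b` -/
  smul (R : Type u) [CommRing R] [Algebra k R] (α s : R)
    (b b' : pNilpotentFunctions k p A →ₐ[k] R) :
    (∀ f : A, b' ⟨fun B => B.1 f, Algebra.subset_adjoin ⟨f, rfl⟩⟩ =
      α * b ⟨fun B => B.1 f, Algebra.subset_adjoin ⟨f, rfl⟩⟩) →
    expPoint map b' s = expPoint map b (α * s)
  /-- every one-parameter subgroup is a product of `ℰ_{B_s} ∘ F^s` with commuting `B_s` -/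
  exists_tuple (ψ : A →ₐ[k] k[X]) : IsAdditiveHom (X : k[X]) ψ →
    ∃ r > 0, ∃ B ∈ commutingTuples k p A r, ψ = expTuple map B
  /-- restriction to `𝔾_{a(r)}` gives an isomorphism of varieties `𝒞_r(𝒩_p(𝔤)) ≅ V_r(G)` -/
  exists_iso (r : ℕ) : 0 < r →
    ∃ e : commutingTuples k p A r ≃ infinitesimalOnePS k p A r,
      (∀ B, (e B).1 = (AdjoinRoot.mkₐ (X ^ p ^ r : k[X])).comp (expTuple map B.1)) ∧
      ∀ g : infinitesimalOnePS k p A r → k,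
        g ∈ infinitesimalOnePSFunctions k p A r ↔ g ∘ e ∈ commutingFunctions k p A r

end ExponentialType

section Filtration

variable {k : Type u} [Field k] {p : ℕ} {A : Type u} [CommRing A] [HopfAlgebra k A]

namespace ExponentialStructure

variable (E : ExponentialStructure k p A) (d : ℕ)

/-- The space of functions `f` on `G` such that `ℰ_B^*(f) ∈ k[T]` has degree at most `d` for
all `B ∈ 𝒩_p(𝔤)`. -/
def degreeLE : Submodule k A :=
  ⨅ B : pNilpotents k p A, (Polynomial.degreeLE k d).comap (expAt E.map B).toLinearMap

/-- The subcoalgebra `(k[G])_{[d]}` of `k[G]`: the largest subcoalgebra consisting of functions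
whose restrictions along all `ℰ_B` have degree at most `d`. -/
def subcoalgebra : Subcoalgebra k A := Subcoalgebra.largest (E.degreeLE d)

lemma one_mem : (1 : A) ∈ (E.subcoalgebra d).carrier := by
  let S : Subcoalgebra k A :=
    { carrier := k ∙ (1 : A)
      comul_mem := fun c hc => by
        obtain ⟨a, rfl⟩ := Submodule.mem_span_singleton.1 hc
        refine ⟨a • ⟨1, Submodule.mem_span_singleton_self _⟩ ⊗ₜ
          ⟨1, Submodule.mem_span_singleton_self _⟩, ?_⟩
        simp [Algebra.TensorProduct.one_def] }
  refine Subcoalgebra.le_largest _ S ?_ (Submodule.mem_span_singleton_self _)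
  simp only [S, Submodule.span_singleton_le_iff_mem, degreeLE, Submodule.mem_iInf]
  intro B
  simp only [Submodule.mem_comap, AlgHom.toLinearMap_apply, map_one, Polynomial.mem_degreeLE]
  exact Polynomial.degree_one_le.trans (by exact_mod_cast d.zero_le)

/-- The functor `M ↦ M_{[d]} = {m ∈ M | Δ_M(m) ∈ M ⊗ (k[G])_{[d]}}` from rational `G`-modules
to `(k[G])_{[d]}`-comodules. -/
abbrev filtration : Comod k A ⥤ Comod k (E.subcoalgebra d).carrier :=
  (E.subcoalgebra d).restrict

/-- The trivial one-dimensional comodule `k` over `(k[G])_{[d]}`. -/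
def trivial : Comod k (E.subcoalgebra d).carrier :=
  trivialComod ⟨1, E.one_mem d⟩
    { counit_eq_one := Bialgebra.counit_one
      comul_eq_tmul_self := by
        apply map_subtype_injective (E.subcoalgebra d).carrier (E.subcoalgebra d).carrier
        refine ((E.subcoalgebra d).map_comul _).trans ?_
        simp [Algebra.TensorProduct.one_def] }

/-- The functor `Hom(k, -)` on `(k[G])_{[d]}`-comodules, with values in `k`-vector spaces. -/
abbrev homTrivial : Comod k (E.subcoalgebra d).carrier ⥤ ModuleCat.{u} k :=
  (linearCoyoneda k _).obj (.op (E.trivial d))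

end ExponentialStructure

end Filtration

section Cohomology

variable (k : Type u) [Field k] (A : Type u) [CommRing A] [HopfAlgebra k A]

/-- The functor `H^0(G, -)` of `G`-invariants `M^G = {m | Δ_M(m) = m ⊗ 1}`. -/
abbrev zerothCohomology : Comod k A ⥤ ModuleCat.{u} k := invariants (1 : A)

/-- Rational cohomology `H^n(G, -)`, the `n`-th right derived functor of `H^0(G, -)`. -/
abbrev cohomology (n : ℕ) : Comod k A ⥤ ModuleCat.{u} k := (zerothCohomology k A).rightDerived n

/-- Convergence `E_2^{s,t} ⇒ H^{s+t}` of a first quadrant cohomological spectral sequence: each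
`H^n` has a finite decreasing filtration
`H^n = F^0 ⊇ F^1 ⊇ ⋯ ⊇ F^{n+1} = 0` with `F^s / F^{s+1} ≅ E_∞^{s,n-s}`. All differentials into and
out of position `(s,t)` on the pages `E_r` with `r ≥ s + t + 2` vanish, so that
`E_∞^{s,t} = E_{s+t+2}^{s,t}`. -/
def ConvergesTo (E : E₂CohomologicalSpectralSequenceNat (ModuleCat.{u} k))
    (H : ℕ → ModuleCat.{u} k) : Prop :=
  ∀ n : ℕ, ∃ F : ℕ → Submodule k (H n), Antitone F ∧ F 0 = ⊤ ∧ F (n + 1) = ⊥ ∧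
    ∀ s t : ℕ, s + t = n →
      Nonempty ((F s ⧸ (F (s + 1)).submoduleOf (F s)) ≃ₗ[k] (E.page (s + t + 2)).X (s, t))

end Cohomology

end
end ExpFiltration

/-! Write S for (k[G])_{[d]}. Two facts reduce the theorem to a Grothendieck spectral sequence.
Since 1 lies in S, an invariant m, for which Δ(m) = m ⊗ 1, already lies in M_{[d]}, and a comodule
map k → M_{[d]} is the choice of such an m (`homTrivialIso`). Moreover (-)_{[d]} is right adjoint to
regarding S-comodules as k[G]-comodules, an operation that preserves monomorphisms; hence (-)_{[d]}
preserves injectives.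

The spectral sequence of a composite G ∘ F with F preserving injectives
(`exists_grothendieckSpectralSequence`) comes from truncations in D⁺(B). The equivalence K⁺(Inj B) ≃
D⁺(B) provides the hypercohomology of G (`hyperderived`). Take an injective resolution R of M and
apply hypercohomology to the truncations of F(R). The piece of F(R) in degree t is R^tF(M) placed in
degree t, and its hypercohomology in degree s + t is R^sG(R^tF(M)): this is the second page. The
terms of F(R) are injective, so the hypercohomology of F(R) itself is the cohomology of G(F(R)),
which is R^n(G ∘ F)(M): this is the abutment.

Convergence holds for every first quadrant spectral object (`convergesTo_E₂SpectralSequenceNat`):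
the abutment is filtered by the images of the H^n(-∞, j), and vanishing outside the quadrant
identifies the graded pieces with a late enough page. -/

/-! ### Spectral objects from homological functors. -/

namespace CategoryTheory.Triangulated.SpectralObject

open Limits Pretriangulated ComposableArrows

variable {C ι A : Type*} [Category* C] [Category* ι] [Category* A] [HasZeroObject C]
  [HasShift C ℤ] [Preadditive C] [∀ (n : ℤ), (shiftFunctor C n).Additive] [Pretriangulated C]
  [Abelian A] (X : SpectralObject C ι) (F : C ⥤ A) [F.IsHomological] [F.ShiftSequence ℤ]

/-- The spectral object in an abelian category obtained by applying a homological functor to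
a spectral object in a pretriangulated category. -/
noncomputable def mapHomologicalFunctor : Abelian.SpectralObject A ι where
  H n := X.ω₁ ⋙ F.shift n
  δ' n₀ n₁ h :=
    { app D := F.homologySequenceδ (X.ω₂.obj D) n₀ n₁ h
      naturality _ _ φ := F.homologySequenceδ_naturality _ _ (X.ω₂.map φ) n₀ n₁ h }
  exact₁' n₀ n₁ h D :=
    (F.homologySequence_exact₁ _ (X.ω₂_obj_distinguished D) n₀ n₁ h).exact_toComposableArrows
  exact₂' n D :=
    (F.homologySequence_exact₂ _ (X.ω₂_obj_distinguished D) n).exact_toComposableArrows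
  exact₃' n₀ n₁ h D :=
    (F.homologySequence_exact₃ _ (X.ω₂_obj_distinguished D) n₀ n₁ h).exact_toComposableArrows

end CategoryTheory.Triangulated.SpectralObject

/-! ### Convergence for first quadrant spectral objects. -/

namespace ExpFiltration

/-- The graded piece attached to `U → V → H` where `U → V → E → 0` is exact modulo `ker (V → H)`. -/
lemma nonempty_range_quotient_equiv {k U V H E : Type*} [Ring k] [AddCommGroup U] [AddCommGroup V]
    [AddCommGroup H] [AddCommGroup E] [Module k U] [Module k V] [Module k H] [Module k E]
    (f : U →ₗ[k] V) (g : V →ₗ[k] H) (q : V →ₗ[k] E) (hq : Function.Surjective q)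
    (hker : LinearMap.ker q = LinearMap.range f ⊔ LinearMap.ker g) :
    Nonempty ((LinearMap.range g ⧸
      (LinearMap.range (g ∘ₗ f)).submoduleOf (LinearMap.range g)) ≃ₗ[k] E) := by
  -- Both sides are quotients of V, so it is enough to compare kernels: each is `range f + ker g`.
  let r := Submodule.mkQ ((LinearMap.range (g ∘ₗ f)).submoduleOf (LinearMap.range g)) ∘ₗ
    g.rangeRestrict
  have hr : Function.Surjective r :=
    (Submodule.mkQ_surjective _).comp g.surjective_rangeRestrict
  have hrq : LinearMap.ker r = LinearMap.ker q := by
    rw [hker]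
    ext v
    have hv : v ∈ LinearMap.ker r ↔ ∃ u, g (f u) = g v := Submodule.Quotient.mk_eq_zero _
    rw [hv, Submodule.mem_sup]
    constructor
    · rintro ⟨u, hu⟩
      refine ⟨f u, ⟨u, rfl⟩, v - f u, ?_, by simp⟩
      rw [LinearMap.mem_ker, map_sub, hu, sub_self]
    · rintro ⟨_, ⟨u, rfl⟩, w, hw, rfl⟩
      refine ⟨u, ?_⟩
      rw [map_add, LinearMap.mem_ker.1 hw, add_zero]
  exact ⟨(r.quotKerEquivOfSurjective hr).symm ≪≫ₗ Submodule.quotEquivOfEq _ _ hrq ≪≫ₗ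
    q.quotKerEquivOfSurjective hq⟩

open Abelian.SpectralObject ComposableArrows Limits

variable {k : Type u} [Field k] (Y : Abelian.SpectralObject (ModuleCat.{u} k) EInt)

/-- The map `H^n(-∞, j) → H^n(-∞, ∞)` of a spectral object. -/
noncomputable abbrev toAbutment (n : ℤ) (j : EInt) :
    (Y.H n).obj (mk₁ (homOfLE (bot_le (a := j)))) ⟶
      (Y.H n).obj (mk₁ (homOfLE (bot_le (a := (⊤ : EInt))))) :=
  (Y.H n).map (twoδ₂Toδ₁' ⊥ j ⊤ bot_le le_top)

/-- The filtration on the abutment `H^n(-∞, ∞)` by the images of the `H^n(-∞, j)`. -/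
noncomputable def abutmentFiltration (n : ℤ) (j : EInt) :
    Submodule k ((Y.H n).obj (mk₁ (homOfLE (bot_le (a := (⊤ : EInt)))))) :=
  LinearMap.range (toAbutment Y n j).hom

lemma map_comp_toAbutment (n : ℤ) {i j : EInt} (h : i ≤ j) :
    (Y.H n).map (twoδ₂Toδ₁' ⊥ i j bot_le h) ≫ toAbutment Y n j = toAbutment Y n i := by
  rw [← Functor.map_comp]
  congr 1

lemma abutmentFiltration_mono (n : ℤ) : Monotone (abutmentFiltration Y n) := by
  intro i j h
  rintro _ ⟨x, rfl⟩
  rw [← map_comp_toAbutment Y n h]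
  exact ⟨_, rfl⟩

/-- The source H^n(-∞, j) is already zero. -/
lemma abutmentFiltration_eq_bot [Y.IsFirstQuadrant] (n : ℤ) (j : EInt) (hj : j ≤ (0 : ℤ)) :
    abutmentFiltration Y n j = ⊥ := by
  have h := (Y.isZero₁_of_isFirstQuadrant ⊥ j bot_le hj n).eq_of_src (toAbutment Y n j) 0
  rw [abutmentFiltration, h]
  exact LinearMap.range_zero

/-- The next term H^n(j, ∞) of the long exact sequence vanishes, so the map to the abutment is onto.
-/
lemma abutmentFiltration_eq_top [Y.IsFirstQuadrant] (n : ℤ) (j : EInt) (hj : (n : EInt) < j) :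
    abutmentFiltration Y n j = ⊤ := by
  have h := (Y.exact₂ (homOfLE (bot_le (a := j))) (homOfLE le_top) _ rfl n).epi_f
    ((Y.isZero₂_of_isFirstQuadrant j ⊤ le_top n hj).eq_of_tgt _ _)
  exact LinearMap.range_eq_top.2 ((ModuleCat.epi_iff_surjective _).1 h)

lemma range_biprod_desc {M N P : ModuleCat.{u} k} (f : M ⟶ P) (g : N ⟶ P) :
    LinearMap.range (biprod.desc f g).hom = LinearMap.range f.hom ⊔ LinearMap.range g.hom := by
  refine le_antisymm ?_ (sup_le ?_ ?_)
  · rintro _ ⟨x, rfl⟩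
    rw [biprod.desc_eq, ModuleCat.hom_add, LinearMap.add_apply]
    exact Submodule.add_mem_sup ⟨_, rfl⟩ ⟨_, rfl⟩
  · rintro _ ⟨x, rfl⟩
    exact ⟨(biprod.inl : M ⟶ M ⊞ N).hom x,
      LinearMap.congr_fun (congrArg ModuleCat.Hom.hom (biprod.inl_desc f g)) x⟩
  · rintro _ ⟨x, rfl⟩
    exact ⟨(biprod.inr : N ⟶ M ⊞ N).hom x,
      LinearMap.congr_fun (congrArg ModuleCat.Hom.hom (biprod.inr_desc f g)) x⟩

/-- The graded pieces of the filtration on the abutment are the objects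
`E^n(-∞ ≤ i ≤ j ≤ ∞)`. -/
lemma nonempty_abutment_quotient_equiv (n₀ n n₂ : ℤ) (h₁ : n₀ + 1 = n) (h₂ : n + 1 = n₂)
    {i j : EInt} (h : i ≤ j) :
    Nonempty ((abutmentFiltration Y n j ⧸
        (abutmentFiltration Y n i).submoduleOf (abutmentFiltration Y n j)) ≃ₗ[k]
      Y.E (homOfLE (bot_le (a := i))) (homOfLE h) (homOfLE (le_top (a := j))) n₀ n n₂) := by
  let S := Y.cokernelSequenceE (homOfLE (bot_le (a := i))) (homOfLE h) (homOfLE (le_top (a := j)))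
    (homOfLE bot_le) rfl n₀ n n₂
  have hS : S.Exact := Y.cokernelSequenceE_exact _ _ _ _ _ _ _ _
  have hepi : Epi S.g := inferInstanceAs (Epi (cokernelSequenceE ..).g)
  -- E is the cokernel of H^n(-∞, i) ⊕ H^{n-1}(j, ∞) → H^n(-∞, j). By exactness the image of the
  -- second summand is the kernel of the map to the abutment.
  have hδ := (Y.exact₁ (homOfLE (bot_le (a := j))) (homOfLE le_top) (homOfLE bot_le) rfl n₀
    n).moduleCat_range_eq_ker
  have := nonempty_range_quotient_equiv
    ((Y.H n).map (twoδ₂Toδ₁' ⊥ i j bot_le h)).hom (toAbutment Y n j).hom S.g.hom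
    ((ModuleCat.epi_iff_surjective _).1 hepi) ?_
  · rwa [← ModuleCat.hom_comp, map_comp_toAbutment] at this
  · refine hS.moduleCat_range_eq_ker.symm.trans ?_
    refine (range_biprod_desc _ _).trans ?_
    exact congrArg (_ ⊔ ·) hδ

/-- A first quadrant spectral object in `k`-vector spaces gives a convergent spectral sequence. -/
lemma convergesTo_E₂SpectralSequenceNat [Y.IsFirstQuadrant] :
    ConvergesTo k Y.E₂SpectralSequenceNat
      fun n => (Y.H n).obj (mk₁ (homOfLE (bot_le (a := (⊤ : EInt))))) := by
  intro n
  -- The index n - s + 1 equals t + 1 when s + t = n, so the graded piece is the one of the interval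
  -- [t, t + 1]. It is n + 1 > n at s = 0, which gives everything, and 0 at s = n + 1, which gives
  -- zero.
  refine ⟨fun s => abutmentFiltration Y n ((n - s + 1 : ℤ) : EInt), fun s s' h => ?_, ?_, ?_, ?_⟩
  · exact abutmentFiltration_mono Y n (WithBotTop.coe_le_coe.2 (by lia))
  · exact abutmentFiltration_eq_top Y n _ (WithBotTop.coe_lt_coe.2 (by lia))
  · exact abutmentFiltration_eq_bot Y n _ (WithBotTop.coe_le_coe.2 (by lia))
  · rintro s t rfl
    have ht : ((t : ℤ) : EInt) ≤ ((t + 1 : ℤ) : EInt) := WithBotTop.coe_le_coe.2 (by lia)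
    obtain ⟨e⟩ := nonempty_abutment_quotient_equiv Y ((s + t : ℕ) - 1 : ℤ) (s + t : ℕ)
      ((s + t : ℕ) + 1 : ℤ) (by lia) rfl ht
    have h₀ : ((-s : ℤ) : EInt) ≤ ((t : ℤ) : EInt) := WithBotTop.coe_le_coe.2 (by lia)
    have h₃ : ((t + 1 : ℤ) : EInt) ≤ ((s + 2 * t + 1 : ℤ) : EInt) :=
      WithBotTop.coe_le_coe.2 (by lia)
    -- On page r the entry (s, t) has outer indices t - r + 2 and t + r - 1; for r = s + t + 2 these
    -- are -s and s + 2t + 1. They may be replaced by -∞ and ∞, because H(-∞, -s) = 0 in all degrees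
    -- and H^m(s + 2t + 1, ∞) = 0 for m ≤ s + t.
    let e₁ := Y.isoMapFourδ₁Toδ₀' ⊥ (-s : ℤ) (t : ℤ) (t + 1 : ℤ) ⊤ bot_le h₀ ht le_top
      ((s + t : ℕ) - 1 : ℤ) (s + t : ℕ) ((s + t : ℕ) + 1 : ℤ)
      (Y.isZero₁_of_isFirstQuadrant _ _ _ (WithBotTop.coe_le_coe.2 (by lia)) _)
    let e₂ := Y.isoMapFourδ₄Toδ₃' (-s : ℤ) (t : ℤ) (t + 1 : ℤ) (s + 2 * t + 1 : ℤ) ⊤ h₀ ht h₃ le_top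
      ((s + t : ℕ) - 1 : ℤ) (s + t : ℕ) ((s + t : ℕ) + 1 : ℤ)
      (Y.isZero₂_of_isFirstQuadrant _ _ _ _ (WithBotTop.coe_lt_coe.2 (by lia)))
    let e₃ := Y.spectralSequencePageXIso coreE₂CohomologicalNat (s + t + 2) (by lia) (s, t)
      (-s : ℤ) (t : ℤ) (t + 1 : ℤ) (s + 2 * t + 1 : ℤ) (by simp; lia) rfl rfl (by simp; lia)
      ((s + t : ℕ) - 1 : ℤ) (s + t : ℕ) ((s + t : ℕ) + 1 : ℤ) (by simp)
    have h (a b : ℤ) (ha : a = t + 1) (hb : b = t) :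
        Nonempty ((abutmentFiltration Y (s + t : ℕ) a ⧸ (abutmentFiltration Y (s + t : ℕ)
          b).submoduleOf (abutmentFiltration Y (s + t : ℕ) a)) ≃ₗ[k]
            (Y.E₂SpectralSequenceNat.page (s + t + 2)).X (s, t)) := by
      subst ha hb
      exact ⟨e ≪≫ₗ (e₁ ≪≫ e₂.symm ≪≫ e₃.symm).toLinearEquiv⟩
    exact h _ _ (by lia) (by lia)

end ExpFiltration

/-! ### Bounded below complexes of injectives and hypercohomology. -/

namespace ExpFiltration

open Limits Pretriangulated DerivedCategory

section

variable (B : Type*) [Category* B] [Abelian B] [HasDerivedCategory B]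

/-- The functor `K⁺(Inj B) ⥤ D⁺(B)`. -/
noncomputable abbrev injectiveToPlus :
    HomotopyCategory.Plus (InjectiveObject B) ⥤ DerivedCategory.Plus B :=
  (InjectiveObject.ι B).mapHomotopyCategoryPlus ⋙ DerivedCategory.Plus.Qh

/-- A bounded below complex of injectives is K-injective, so morphisms into it agree in the homotopy
and derived categories; and K⁺(Inj B) → K⁺(B) is fully faithful because the inclusion of the
injectives is. -/
lemma injectiveToPlus_map_bijective (K L : HomotopyCategory.Plus (InjectiveObject B)) :
    Function.Bijective ((injectiveToPlus B).map : (K ⟶ L) → _) := by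
  have h : CochainComplex.IsKInjective
      ((InjectiveObject.ι B).mapHomotopyCategoryPlus.obj L).obj.as := by
    obtain ⟨L, rfl⟩ := HomotopyCategory.Plus.quotient_obj_surjective L
    exact inferInstanceAs (CochainComplex.IsKInjective
      (((InjectiveObject.ι B).mapHomologicalComplex (.up ℤ)).obj L.obj))
  exact (DerivedCategory.Plus.Qh_map_bijective_of_isKInjective _ _ h).comp
    ((Functor.FullyFaithful.ofFullyFaithful
      (InjectiveObject.ι B).mapHomotopyCategoryPlus).map_bijective K L)

instance : (injectiveToPlus B).Full := ⟨(injectiveToPlus_map_bijective B _ _).surjective⟩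

instance : (injectiveToPlus B).Faithful :=
  ⟨fun h => (injectiveToPlus_map_bijective B _ _).injective h⟩

instance [EnoughInjectives B] : (injectiveToPlus B).EssSurj where
  mem_essImage X := by
    obtain ⟨n, hn⟩ := X.property
    have : X.IsGE n := (X.isGE_ι_obj_iff n).1 hn
    obtain ⟨L, _, ⟨e⟩⟩ := DerivedCategory.Plus.exists_injective_nonempty_iso X n
    exact ⟨(HomotopyCategory.Plus.quotient _).obj L, ⟨e⟩⟩

instance [EnoughInjectives B] : (injectiveToPlus B).IsEquivalence where

variable [EnoughInjectives B]

/-- The equivalence `K⁺(Inj B) ≌ D⁺(B)`. -/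
noncomputable abbrev injectiveEquivalence :
    HomotopyCategory.Plus (InjectiveObject B) ≌ DerivedCategory.Plus B :=
  (injectiveToPlus B).asEquivalence

noncomputable instance : (injectiveEquivalence B).functor.CommShift ℤ :=
  inferInstanceAs ((injectiveToPlus B).CommShift ℤ)

noncomputable instance : (injectiveEquivalence B).inverse.CommShift ℤ :=
  (injectiveEquivalence B).commShiftInverse ℤ

instance : (injectiveEquivalence B).CommShift ℤ :=
  (injectiveEquivalence B).commShift_of_functor ℤ

instance : (injectiveEquivalence B).functor.IsTriangulated :=
  inferInstanceAs ((injectiveToPlus B).IsTriangulated)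

/-- Precomposing a homological functor with this inverse keeps it homological; this is what
`hyperderived` relies on. -/
instance : (injectiveEquivalence B).inverse.IsTriangulated :=
  (Equivalence.IsTriangulated.mk' (injectiveEquivalence B) inferInstance).rightAdjoint_isTriangulated

end

section

variable {B D : Type*} [Category* B] [Abelian B] [HasDerivedCategory B] [EnoughInjectives B]
  [Category* D] [Abelian D] (G : B ⥤ D) [G.Additive]

/-- The functor `K⁺(Inj B) ⥤ D` which sends a complex `K` to `H^n(G(K))`. -/
noncomputable abbrev injectiveHomology (n : ℤ) : HomotopyCategory.Plus (InjectiveObject B) ⥤ D :=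
  ((InjectiveObject.ι B ⋙ G).mapHomotopyCategoryPlus ⋙ HomotopyCategory.Plus.ι D) ⋙
    HomotopyCategory.homologyFunctor D (.up ℤ) n

noncomputable instance : (injectiveHomology G 0).ShiftSequence ℤ := inferInstance
instance : (injectiveHomology G 0).IsHomological := inferInstance

/-- The zeroth hypercohomology functor `D⁺(B) ⥤ D` attached to `G : B ⥤ D`. -/
noncomputable def hyperderived : DerivedCategory.Plus B ⥤ D :=
  (injectiveEquivalence B).inverse ⋙ injectiveHomology G 0

noncomputable instance : (hyperderived G).ShiftSequence ℤ :=
  inferInstanceAs (((injectiveEquivalence B).inverse ⋙ injectiveHomology G 0).ShiftSequence ℤ)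

instance : (hyperderived G).IsHomological :=
  inferInstanceAs (((injectiveEquivalence B).inverse ⋙ injectiveHomology G 0).IsHomological)

/-- Hypercohomology is computed by bounded below complexes of injective objects. -/
noncomputable def hyperderivedShiftObjIso (L : CochainComplex.Plus (InjectiveObject B)) (n : ℤ) :
    ((hyperderived G).shift n).obj (DerivedCategory.Plus.Q.obj
      ((InjectiveObject.ι B).mapCochainComplexPlus.obj L)) ≅
    ((G.mapHomologicalComplex (.up ℤ)).obj
      ((InjectiveObject.ι B).mapCochainComplexPlus.obj L).obj).homology n :=
  -- The n-th shift of `hyperderived G` is the inverse equivalence followed by `injectiveHomology G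
  -- n`; the unit cancels the inverse against the passage to D⁺(B).
  (injectiveHomology G n).mapIso
    ((injectiveEquivalence B).unitIso.symm.app ((HomotopyCategory.Plus.quotient _).obj L)) ≪≫
  (HomotopyCategory.homologyFunctorFactors D (.up ℤ) n).app _

end

end ExpFiltration

/-! ### Hypercohomology and right derived functors. -/

namespace ExpFiltration

open Limits Pretriangulated DerivedCategory

/-- The commutation of `mapExtendIso` with differentials in nonnegative degrees, where the
differential of an extended complex is the original one conjugated by isomorphisms. -/
lemma map_iso_conj_comp {B D : Type*} [Category* B] [Category* D] (G : B ⥤ D) {U V W Z : B} {P Q : D} (a : U ≅ V) (f : V ⟶ W) (b : Z ≅ W)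
    (x : P ≅ G.obj V) (y : Q ≅ G.obj W) :
    (G.map a.hom ≫ x.inv) ≫ x.hom ≫ G.map f ≫ y.inv =
      G.map (a.hom ≫ f ≫ b.inv) ≫ G.map b.hom ≫ y.inv := by
  simp

section

variable {B D : Type*} [Category* B] [Preadditive B] [HasZeroObject B]
  [Category* D] [Preadditive D] [HasZeroObject D] (G : B ⥤ D) [G.Additive]

/-- Additive functors commute with the extension of cochain complexes from `ℕ` to `ℤ`. -/
noncomputable def mapExtendIso (K : CochainComplex B ℕ) :
    (G.mapHomologicalComplex (.up ℤ)).obj (K.extend ComplexShape.embeddingUpNat) ≅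
      ((G.mapHomologicalComplex (.up ℕ)).obj K).extend ComplexShape.embeddingUpNat :=
  have hofNat (i : ℕ) : ComplexShape.embeddingUpNat.f i = Int.ofNat i := rfl
  HomologicalComplex.Hom.isoOfComponents
    (fun n => match n with
      | .ofNat k =>
        G.mapIso (K.extendXIso ComplexShape.embeddingUpNat (hofNat k)) ≪≫
          (((G.mapHomologicalComplex (.up ℕ)).obj K).extendXIso
            ComplexShape.embeddingUpNat (hofNat k)).symm
      | .negSucc k =>
        (G.map_isZero (K.isZero_extend_X ComplexShape.embeddingUpNat _
            fun i => by simp)).iso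
          (HomologicalComplex.isZero_extend_X _ ComplexShape.embeddingUpNat _
            fun i => by simp))
    (by
      rintro i j (rfl : i + 1 = j)
      obtain i | i := i
      · refine (congrArg (_ ≫ ·) (((G.mapHomologicalComplex (.up ℕ)).obj K).extend_d_eq
          ComplexShape.embeddingUpNat (hofNat i) (hofNat (i + 1)))).trans (Eq.trans ?_
            (congrArg (G.map · ≫ _) (K.extend_d_eq
              ComplexShape.embeddingUpNat (hofNat i) (hofNat (i + 1)))).symm)
        exact map_iso_conj_comp G (K.extendXIso ComplexShape.embeddingUpNat (hofNat i)) _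
          (K.extendXIso ComplexShape.embeddingUpNat (hofNat (i + 1))) _ _
      · exact (G.map_isZero (K.isZero_extend_X ComplexShape.embeddingUpNat _
            fun i => by simp)).eq_of_src _ _)

end

section

variable {B D : Type*} [Category* B] [Abelian B] [EnoughInjectives B]
  [Category* D] [Abelian D] (G : B ⥤ D) [G.Additive]

/-- Right derived functors are computed by injective resolutions, seen as cochain complexes
indexed by `ℤ`. -/
noncomputable def homologyMapCochainComplexIso {N : B} (R : InjectiveResolution N) (n : ℕ) :
    ((G.mapHomologicalComplex (.up ℤ)).obj R.cochainComplex).homology n ≅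
      (G.rightDerived n).obj N :=
  (HomologicalComplex.homologyFunctor D _ (n : ℤ)).mapIso (mapExtendIso G R.cocomplex) ≪≫
    HomologicalComplex.extendHomologyIso _ ComplexShape.embeddingUpNat (by rfl) ≪≫
    (R.isoRightDerivedObj G n).symm

variable [HasDerivedCategory B]

/-- Hypercohomology is computed by bounded below complexes of injective objects. -/
noncomputable def hyperderivedShiftIso (K : CochainComplex.Plus B)
    [∀ i, Injective (K.obj.X i)] (n : ℤ) :
    ((hyperderived G).shift n).obj (Plus.Q.obj K) ≅
      ((G.mapHomologicalComplex (.up ℤ)).obj K.obj).homology n :=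
  hyperderivedShiftObjIso G
    ⟨HomologicalComplex.liftObjectProperty _ K.obj inferInstance, K.property.imp fun n hn => by
      rwa [← CochainComplex.isStrictlyGE_mapHomologicalComplex_obj_iff _ (InjectiveObject.ι _)]⟩ n

/-- An object of D^{≥ a} has an injective model that is zero below a, so the complex computing its
hypercohomology is zero there too. -/
lemma isZero_hyperderived_shift (X : DerivedCategory.Plus B) (n a : ℤ) (h : n < a) [X.IsGE a] :
    IsZero (((hyperderived G).shift n).obj X) := by
  obtain ⟨L, _, ⟨e⟩⟩ := DerivedCategory.Plus.exists_injective_nonempty_iso X a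
  refine IsZero.of_iso ?_ (((hyperderived G).shift n).mapIso e.symm ≪≫
    hyperderivedShiftObjIso G L n)
  apply ShortComplex.isZero_homology_of_isZero_X₂
  exact (InjectiveObject.ι B ⋙ G).map_isZero (CochainComplex.isZero_of_isStrictlyGE L.obj a n h)

/-- An injective resolution as a bounded below complex. -/
noncomputable abbrev resolutionPlus {N : B} (R : InjectiveResolution N) : CochainComplex.Plus B :=
  ⟨R.cochainComplex, 0, inferInstance⟩

/-- An object is isomorphic to its injective resolutions in the derived category. -/
noncomputable def singleIsoResolution {N : B} (R : InjectiveResolution N) :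
    (Plus.singleFunctor B 0).obj N ≅ Plus.Q.obj (resolutionPlus R) :=
  let e := asIso (DerivedCategory.Q.map R.ι')
  Plus.ι.preimageIso ((DerivedCategory.singleFunctorIsoCompQ B 0).app N ≪≫ e)

/-- The hypercohomology of an object in degree `t` is computed by right derived functors. -/
noncomputable def hyperderivedSingleIso (N : B) (s : ℕ) (t : ℤ) :
    ((hyperderived G).shift (s + t)).obj ((Plus.singleFunctor B t).obj N) ≅
      (G.rightDerived s).obj N :=
  -- Degree s + t of an object is degree s of its shift by t, and N in degree t shifted by t is N in
  -- degree 0, which an injective resolution represents.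
  ((hyperderived G).shiftIso t (s : ℤ) ((s : ℤ) + t) (add_comm _ _)).symm.app _ ≪≫
    ((hyperderived G).shift (s : ℤ)).mapIso
      (((Plus.singleFunctors B).shiftIso t 0 t (add_zero t)).app N ≪≫
        singleIsoResolution (injectiveResolution N)) ≪≫
    hyperderivedShiftIso G (resolutionPlus (injectiveResolution N)) s ≪≫
    homologyMapCochainComplexIso G _ s

end

end ExpFiltration

/-! ### Truncations and the second page. -/

namespace ExpFiltration

open Limits Pretriangulated DerivedCategory ComposableArrows

section

variable {B D : Type*} [Category* B] [Abelian B] [HasDerivedCategory B]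
  [Category* D] [Abelian D]

/-- In the long exact sequence the neighbours of this map are H^{n-1} and H^n of the third vertex,
and both vanish. -/
lemma isIso_homologyFunctor_map_mor₁ (T : Triangle (DerivedCategory.Plus B))
    (hT : T ∈ distTriang _) (n : ℤ) [T.obj₃.IsGE (n + 1)] :
    IsIso ((Plus.homologyFunctor B n).map T.mor₁) := by
  have hT' := Plus.ι.map_distinguished T hT
  have h₁ : Epi ((Plus.homologyFunctor B n).map T.mor₁) :=
    (HomologySequence.epi_homologyMap_mor₁_iff _ hT' n).2
      ((T.obj₃.isZero_homology_of_isGE (n + 1) n (by lia)).eq_of_tgt _ _)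
  have h₂ : Mono ((Plus.homologyFunctor B n).map T.mor₁) :=
    (HomologySequence.mono_homologyMap_mor₁_iff _ hT' (n - 1) n).2
      ((T.obj₃.isZero_homology_of_isGE (n + 1) (n - 1) (by lia)).eq_of_src _ _)
  exact isIso_of_mono_of_epi _

/-- Here the neighbours are H^n and H^{n+1} of the first vertex, which vanish. -/
lemma isIso_homologyFunctor_map_mor₂ (T : Triangle (DerivedCategory.Plus B))
    (hT : T ∈ distTriang _) (n : ℤ) [T.obj₁.IsLE (n - 1)] :
    IsIso ((Plus.homologyFunctor B n).map T.mor₂) := by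
  have hT' := Plus.ι.map_distinguished T hT
  have h₁ : Epi ((Plus.homologyFunctor B n).map T.mor₂) :=
    (HomologySequence.epi_homologyMap_mor₂_iff _ hT' n (n + 1)).2
      ((T.obj₁.isZero_homology_of_isLE (n - 1) (n + 1) (by lia)).eq_of_tgt _ _)
  have h₂ : Mono ((Plus.homologyFunctor B n).map T.mor₂) :=
    (HomologySequence.mono_homologyMap_mor₂_iff _ hT' n).2
      ((T.obj₁.isZero_homology_of_isLE (n - 1) n (by lia)).eq_of_src _ _)
  exact isIso_of_mono_of_epi _

/-- The truncation of `X` concentrated in degree `t` is `H^t(X)` placed in degree `t`. -/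
lemma nonempty_truncGELT_iso_single (X : DerivedCategory.Plus B) (t : ℤ) :
    Nonempty ((Plus.TStructure.t.truncGE t).obj ((Plus.TStructure.t.truncLT (t + 1)).obj X) ≅
      (Plus.singleFunctor B t).obj ((Plus.homologyFunctor B t).obj X)) := by
  let X' := (Plus.TStructure.t.truncLT (t + 1)).obj X
  let Z := (Plus.TStructure.t.truncGE t).obj X'
  have h₁ : (Plus.ι.obj Z).IsGE t := (Z.isGE_ι_obj_iff t).2 inferInstance
  have h₂ : (Plus.ι.obj Z).IsLE t := (Z.isLE_ι_obj_iff t).2 inferInstance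
  obtain ⟨N, ⟨e⟩⟩ := DerivedCategory.exists_iso_singleFunctor_obj_of_isGE_of_isLE (Plus.ι.obj Z) t
  let e' : Z ≅ (Plus.singleFunctor B t).obj N := Plus.ι.preimageIso e
  have h₃ := isIso_homologyFunctor_map_mor₁ _
    (Plus.TStructure.t.triangleLTGE_distinguished (t + 1) X) t
  have h₄ := isIso_homologyFunctor_map_mor₂ _
    (Plus.TStructure.t.triangleLTGE_distinguished t X') t
  let f : (Plus.homologyFunctor B t).obj X' ≅ (Plus.homologyFunctor B t).obj X := @asIso _ _ _ _ _ h₃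
  let g : (Plus.homologyFunctor B t).obj X' ≅ (Plus.homologyFunctor B t).obj Z := @asIso _ _ _ _ _ h₄
  -- The object N placed in degree t is identified by its H^t: both τ^{<t+1}X → X and τ^{<t+1}X →
  -- τ^{≥t}τ^{<t+1}X induce isomorphisms on H^t.
  let c : N ≅ (Plus.homologyFunctor B t).obj X :=
    (DerivedCategory.singleFunctorCompHomologyFunctorIso B t).symm.app N ≪≫
      (DerivedCategory.homologyFunctor B t).mapIso e.symm ≪≫ g.symm ≪≫ f
  exact ⟨e' ≪≫ (Plus.singleFunctor B t).mapIso c⟩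

variable [EnoughInjectives B] (G : B ⥤ D) [G.Additive]

/-- The spectral object attached to the hypercohomology of the truncations of `X`. -/
noncomputable abbrev hyperderivedSpectralObject (X : DerivedCategory.Plus B) :
    Abelian.SpectralObject D EInt :=
  (Plus.TStructure.t.spectralObject X).mapHomologicalFunctor (hyperderived G)

/-- For j ≤ 0 the truncation τ^{<j}X is zero since X lies in D^{≥ 0}. For n < i the truncation
τ^{≥i} lies in D^{≥ n+1}, so it has no hypercohomology in degree n. -/
instance (X : DerivedCategory.Plus B) [X.IsGE 0] :
    (hyperderivedSpectralObject G X).IsFirstQuadrant where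
  isZero₁ i j hij hj n :=
    (Plus.TStructure.t.eTruncGE.obj i ⋙ (hyperderived G).shift n).map_isZero
      (Plus.TStructure.t.isZero_eTruncLT_obj_obj X 0 j hj)
  isZero₂ i j hij n hi := by
    have : Plus.IsGE ((Plus.TStructure.t.eTruncGE.obj i).obj
        ((Plus.TStructure.t.eTruncLT.obj j).obj X)) (n + 1) := by
      apply Plus.TStructure.t.isGE_eTruncGE_obj_obj
      induction i using WithBotTop.rec with
      | bot => simp at hi
      | coe i =>
        simp only [WithBotTop.coe_lt_coe] at hi
        simpa
      | top => simp
    exact isZero_hyperderived_shift G ((Plus.TStructure.t.eTruncGE.obj i).obj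
      ((Plus.TStructure.t.eTruncLT.obj j).obj X)) n (n + 1) (by lia)

/-- The second page of the hypercohomology spectral sequence. -/
lemma nonempty_hyperderived_page_two_iso (X : DerivedCategory.Plus B) [X.IsGE 0] (s t : ℕ) :
    Nonempty (((hyperderivedSpectralObject G X).E₂SpectralSequenceNat.page 2 le_rfl).X (s, t) ≅
      (G.rightDerived s).obj ((Plus.homologyFunctor B t).obj X)) := by
  obtain ⟨e⟩ := nonempty_truncGELT_iso_single X t
  -- The entry (s, t) is the hypercohomology in degree s + t of the truncation of X to the interval
  -- [t, t + 1), that is, of H^t(X) placed in degree t.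
  exact ⟨(hyperderivedSpectralObject G X).spectralSequenceFirstPageXIso
    Abelian.SpectralObject.coreE₂CohomologicalNat (s, t) (t : ℤ) ((t + 1 : ℤ)) rfl rfl
    ((s : ℤ) + t) rfl ≪≫ ((hyperderived G).shift ((s : ℤ) + t)).mapIso e ≪≫
      hyperderivedSingleIso G _ s t⟩

end

end ExpFiltration

/-! ### The Grothendieck spectral sequence. -/

namespace ExpFiltration

open Limits Pretriangulated DerivedCategory

/-- Convergence only depends on the isomorphism classes of the terms of the abutment. -/
lemma ConvergesTo.of_iso {k : Type u} [Field k]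
    {S : E₂CohomologicalSpectralSequenceNat (ModuleCat.{u} k)} {H H' : ℕ → ModuleCat.{u} k}
    (h : ConvergesTo k S H) (e : ∀ n, H n ≅ H' n) : ConvergesTo k S H' := by
  intro n
  obtain ⟨F, hF, h₀, h₁, hq⟩ := h n
  let f : H n ≃ₗ[k] H' n := (e n).toLinearEquiv
  refine ⟨fun s => (F s).map f.toLinearMap, fun s t hst => Submodule.map_mono (hF hst),
    by simp [h₀], by simp [h₁], fun s t hst => ?_⟩
  obtain ⟨g⟩ := hq s t hst
  refine ⟨(Submodule.Quotient.equiv _ _ (f.submoduleMap (F s)) ?_).symm ≪≫ₗ g⟩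
  ext ⟨x, hx⟩
  obtain ⟨y, hy, rfl⟩ := hx
  simp [Submodule.submoduleOf]

section

variable {A B D : Type*} [Category* A] [Abelian A] [EnoughInjectives A]
  [Category* B] [Abelian B] [EnoughInjectives B] [Category* D] [Abelian D]

/-- Isomorphic functors have isomorphic right derived functors. -/
noncomputable def rightDerivedIso {F G : A ⥤ D} [F.Additive] [G.Additive] (e : F ≅ G) (n : ℕ) :
    F.rightDerived n ≅ G.rightDerived n where
  hom := NatTrans.rightDerived e.hom n
  inv := NatTrans.rightDerived e.inv n
  hom_inv_id := by rw [← NatTrans.rightDerived_comp, e.hom_inv_id, NatTrans.rightDerived_id]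
  inv_hom_id := by rw [← NatTrans.rightDerived_comp, e.inv_hom_id, NatTrans.rightDerived_id]

variable (F : A ⥤ B) [F.Additive] (G : B ⥤ D) [G.Additive] [HasDerivedCategory B]
  {M : A} (R : InjectiveResolution M)

/-- The image in the derived category of `F` applied to an injective resolution. -/
noncomputable abbrev derivedObj : DerivedCategory.Plus B :=
  Plus.Q.obj (F.mapCochainComplexPlus.obj (resolutionPlus R))

instance : (derivedObj F R).IsGE 0 := by
  rw [← Plus.isGE_ι_obj_iff]
  exact (DerivedCategory.isGE_Q_obj_iff
    ((F.mapHomologicalComplex (.up ℤ)).obj R.cochainComplex) 0).2 inferInstance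

/-- The cohomology of `F` applied to an injective resolution. -/
noncomputable def homologyDerivedObjIso (n : ℕ) :
    (Plus.homologyFunctor B n).obj (derivedObj F R) ≅ (F.rightDerived n).obj M :=
  (DerivedCategory.homologyFunctorFactors B n).app _ ≪≫ homologyMapCochainComplexIso F R n

variable [F.PreservesInjectiveObjects]

/-- The hypercohomology of `F` applied to an injective resolution. -/
noncomputable def hyperderivedDerivedObjIso (n : ℕ) :
    ((hyperderived G).shift (n : ℤ)).obj (derivedObj F R) ≅ ((F ⋙ G).rightDerived n).obj M :=
  -- As F preserves injectives, F(R) is itself a complex of injectives and computes its own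
  -- hypercohomology; applying G to it is applying F ⋙ G to R.
  have (i : ℤ) : Injective ((F.mapCochainComplexPlus.obj (resolutionPlus R)).obj.X i) :=
    inferInstanceAs (Injective (F.obj (R.cochainComplex.X i)))
  hyperderivedShiftIso G _ n ≪≫ homologyMapCochainComplexIso (F ⋙ G) R n

end

/-- The Grothendieck spectral sequence of a composition of functors. -/
theorem exists_grothendieckSpectralSequence {A B : Type*} [Category* A] [Abelian A]
    [EnoughInjectives A] [Category* B] [Abelian B] [EnoughInjectives B] {k : Type u} [Field k]
    (F : A ⥤ B) [F.Additive] [F.PreservesInjectiveObjects] (G : B ⥤ ModuleCat.{u} k) [G.Additive]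
    (M : A) :
    ∃ S : E₂CohomologicalSpectralSequenceNat (ModuleCat.{u} k),
      (∀ s t : ℕ, Nonempty ((S.page 2 le_rfl).X (s, t) ≅
        (G.rightDerived s).obj ((F.rightDerived t).obj M))) ∧
      ConvergesTo k S fun n => ((F ⋙ G).rightDerived n).obj M := by
  let _ := HasDerivedCategory.standard B
  let R := injectiveResolution M
  refine ⟨(hyperderivedSpectralObject G (derivedObj F R)).E₂SpectralSequenceNat, fun s t => ?_,
    (convergesTo_E₂SpectralSequenceNat _).of_iso fun n => hyperderivedDerivedObjIso F G R n⟩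
  obtain ⟨e⟩ := nonempty_hyperderived_page_two_iso G (derivedObj F R) s t
  exact ⟨e ≪≫ (G.rightDerived s).mapIso (homologyDerivedObjIso F R t)⟩

end ExpFiltration

/-! ### Restriction to a subcoalgebra preserves injectives. -/

namespace ExpFiltration

noncomputable section

variable {k : Type u} [Field k] {C : Type u} [AddCommGroup C] [Module k C] [Coalgebra k C]

lemma lTensor_rTensor_apply {V V' W W' : Type u} [AddCommGroup V] [Module k V] [AddCommGroup V']
    [Module k V'] [AddCommGroup W] [Module k W] [AddCommGroup W'] [Module k W'] (f : V →ₗ[k] V')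
    (g : W →ₗ[k] W') (x : V ⊗[k] W) :
    g.lTensor V' (f.rTensor W x) = f.rTensor W' (g.lTensor V x) := by
  rw [← LinearMap.comp_apply, ← LinearMap.comp_apply, LinearMap.lTensor_comp_rTensor,
    LinearMap.rTensor_comp_lTensor]

lemma map_rTensor_apply {V V' V'' W W' : Type u} [AddCommGroup V] [Module k V] [AddCommGroup V']
    [Module k V'] [AddCommGroup V''] [Module k V''] [AddCommGroup W] [Module k W] [AddCommGroup W']
    [Module k W'] (f : V →ₗ[k] V') (i : V' →ₗ[k] V'') (j : W →ₗ[k] W') (x : V ⊗[k] W) :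
    TensorProduct.map i j (f.rTensor W x) = (i ∘ₗ f).rTensor W' (j.lTensor V x) := by
  rw [← LinearMap.comp_apply, ← LinearMap.comp_apply, LinearMap.map_comp_rTensor,
    LinearMap.rTensor_comp_lTensor]

/-- A linear map compatible with the coactions is a morphism of comodules. -/
def Comod.homMk {M N : Comod k C} (f : M.A →ₗ[k] N.A)
    (h : ∀ m, N.coaction (f m) = f.rTensor C (M.coaction m)) : M ⟶ N where
  f := ModuleCat.ofHom f
  h := by
    ext m
    exact (h m).symm

namespace Subcoalgebra

variable (S : Subcoalgebra k C)

lemma map_subtype_comul : TensorProduct.map S.carrier.subtype S.carrier.subtype ∘ₗ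
    Coalgebra.comul (R := k) = Coalgebra.comul (R := k) ∘ₗ S.carrier.subtype := by
  ext c
  exact S.map_comul c

/-- An `S`-comodule is a `C`-comodule. -/
def corestrictObj (N : Comod k S.carrier) : Comod k C :=
  Comod.ofCoaction (S.carrier.subtype.lTensor N.A ∘ₗ N.coaction)
    (by
      ext n
      refine Eq.trans ?_ (Comod.counit_apply N n)
      simp only [LinearMap.comp_apply, ← LinearMap.lTensor_comp_apply]
      rfl)
    (by
      have h : (TensorProduct.assoc k N.A S.carrier S.carrier).toLinearMap ∘ₗ
          N.coaction.rTensor S.carrier ∘ₗ N.coaction =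
          Coalgebra.comul.lTensor N.A ∘ₗ N.coaction :=
        LinearMap.ext N.coassoc_apply
      -- The iterated coaction over C is that over S followed by S ⊗ S ⊆ C ⊗ C. Coassociativity of N
      -- and the compatibility of the two comultiplications finish the proof.
      have h' : (TensorProduct.assoc k N.A C C).toLinearMap ∘ₗ
          (S.carrier.subtype.lTensor N.A ∘ₗ N.coaction).rTensor C ∘ₗ
            S.carrier.subtype.lTensor N.A =
          TensorProduct.map LinearMap.id (TensorProduct.map S.carrier.subtype S.carrier.subtype) ∘ₗ
            (TensorProduct.assoc k N.A S.carrier S.carrier).toLinearMap ∘ₗ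
              N.coaction.rTensor S.carrier := by
        refine TensorProduct.ext' fun n c => ?_
        simp only [LinearMap.comp_apply, LinearMap.lTensor_tmul, LinearMap.rTensor_tmul,
          LinearEquiv.coe_coe, map_assoc]
        rfl
      rw [← LinearMap.comp_assoc N.coaction, ← LinearMap.comp_assoc N.coaction, h',
        LinearMap.comp_assoc, LinearMap.comp_assoc, h, ← LinearMap.comp_assoc,
        ← LinearMap.comp_assoc, ← LinearMap.lTensor_comp, ← S.map_subtype_comul,
        LinearMap.lTensor_comp]
      rfl)

/-- A morphism of `S`-comodules is a morphism of `C`-comodules. -/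
def corestrictMap {N N' : Comod k S.carrier} (f : N ⟶ N') :
    S.corestrictObj N ⟶ S.corestrictObj N' :=
  Comod.homMk (M := S.corestrictObj N) (N := S.corestrictObj N') f.f.hom fun n =>
    (congrArg (S.carrier.subtype.lTensor N'.A) (Comod.coaction_hom f n)).trans
      (lTensor_rTensor_apply _ _ _)

/-- The underlying linear map is unchanged, and the forgetful functors preserve and reflect
monomorphisms. -/
instance {N N' : Comod k S.carrier} (f : N ⟶ N') [Mono f] : Mono (S.corestrictMap f) :=
  (tensorComonad k C).forget.mono_of_mono_map
    (inferInstanceAs (Mono ((tensorComonad k S.carrier).forget.map f)))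

/-- The morphism `N ⟶ {m | Δ_M(m) ∈ M ⊗ S}` attached to a compatible linear map `N → M`, for an
`S`-comodule `N` and a `C`-comodule `M`. -/
def liftRestrict {N : Comod k S.carrier} {M : Comod k C} (f : N.A →ₗ[k] M.A)
    (hf : ∀ n, M.coaction (f n) = f.rTensor C (S.carrier.subtype.lTensor N.A (N.coaction n))) :
    N ⟶ S.restrict.obj M :=
  have hmem (n : N.A) : f n ∈ S.restrictSubmodule M :=
    ⟨f.rTensor S.carrier (N.coaction n), by rw [hf, lTensor_rTensor_apply]⟩
  let f' : N.A →ₗ[k] S.restrictSubmodule M := f.codRestrict (S.restrictSubmodule M) hmem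
  have h (n : N.A) : S.restrictCoaction M (f' n) = f'.rTensor S.carrier (N.coaction n) := by
    apply map_subtype_injective (S.restrictSubmodule M) S.carrier
    rw [S.map_restrictCoaction, map_rTensor_apply]
    exact hf n
  Comod.homMk (M := N) (N := S.restrict.obj M) f' h

/-- The morphism `N ⟶ M` attached to a morphism `N ⟶ {m | Δ_M(m) ∈ M ⊗ S}`, for an
`S`-comodule `N` and a `C`-comodule `M`. -/
def descRestrict {N : Comod k S.carrier} {M : Comod k C} (g : N ⟶ S.restrict.obj M) :
    S.corestrictObj N ⟶ M :=
  Comod.homMk (M := S.corestrictObj N) (N := M) (S.restrictInclusion M ∘ₗ g.f.hom) fun n =>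
    (S.map_restrictCoaction M _).symm.trans <|
      (congrArg (TensorProduct.map (S.restrictSubmodule M).subtype S.carrier.subtype)
        (Comod.coaction_hom g n)).trans (map_rTensor_apply g.f.hom _ _ _)

/-- A right adjoint of a functor preserving monomorphisms preserves injectives. Here the adjunction
is used by hand: `descRestrict` transposes the map to C-comodules, injectivity of M extends it, and
`liftRestrict` transposes back. -/
instance : S.restrict.PreservesInjectiveObjects where
  injective_obj {M} _ :=
    { factors {X Y} g f _ := by
        let h := Injective.factorThru (S.descRestrict g) (S.corestrictMap f)
        refine ⟨S.liftRestrict h.f.hom (Comod.coaction_hom h), ?_⟩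
        ext x
        apply (S.restrictSubmodule M).subtype_injective
        exact LinearMap.congr_fun (congrArg (fun h => h.f.hom)
          (Injective.comp_factorThru (S.descRestrict g) (S.corestrictMap f))) x }

end Subcoalgebra

end

/-! ### Invariants as maps from the trivial comodule, and the theorem. -/

noncomputable section

namespace ExponentialStructure

variable {k : Type u} [Field k] {p : ℕ} {A : Type u} [CommRing A] [HopfAlgebra k A]
  (E : ExponentialStructure k p A) (d : ℕ)

lemma invariant_of_hom (M : Comod k A) (φ : E.trivial d ⟶ (E.filtration d).obj M) :
    M.coaction ((E.subcoalgebra d).restrictInclusion M (φ.f.hom (1 : k))) =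
      (E.subcoalgebra d).restrictInclusion M (φ.f.hom (1 : k)) ⊗ₜ[k] (1 : A) := by
  refine ((E.subcoalgebra d).map_restrictCoaction M _).symm.trans ?_
  have h : ((E.subcoalgebra d).restrict.obj M).coaction (φ.f.hom (1 : k)) =
      φ.f.hom (1 : k) ⊗ₜ[k] (⟨1, E.one_mem d⟩ : (E.subcoalgebra d).carrier) :=
    Comod.coaction_hom φ (1 : k)
  exact congrArg (TensorProduct.map ((E.subcoalgebra d).restrictSubmodule M).subtype
    (E.subcoalgebra d).carrier.subtype) h

/-- Because 1 lies in the subcoalgebra, truncating M to M_{[d]} loses no invariants. -/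
lemma mem_restrictSubmodule_of_invariant (M : Comod k A) (m : M.A)
    (hm : M.coaction m = m ⊗ₜ[k] (1 : A)) : m ∈ (E.subcoalgebra d).restrictSubmodule M :=
  ⟨m ⊗ₜ[k] ⟨1, E.one_mem d⟩, hm.symm⟩

/-- The morphism `k ⟶ M_{[d]}` sending `1` to an invariant `m`. -/
def homOfInvariant (M : Comod k A) (m : M.A) (hm : M.coaction m = m ⊗ₜ[k] (1 : A)) :
    E.trivial d ⟶ (E.filtration d).obj M :=
  Comod.homMk (M := E.trivial d) (N := (E.filtration d).obj M)
    (LinearMap.toSpanSingleton k ((E.subcoalgebra d).restrictSubmodule M)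
      ⟨m, E.mem_restrictSubmodule_of_invariant d M m hm⟩) fun (a : k) => by
      apply map_subtype_injective ((E.subcoalgebra d).restrictSubmodule M)
        (E.subcoalgebra d).carrier
      refine ((E.subcoalgebra d).map_restrictCoaction M _).trans ?_
      change M.coaction (a • m) = (a • m) ⊗ₜ[k] (1 : A)
      rw [map_smul, hm, TensorProduct.smul_tmul']

/-- Morphisms `k ⟶ M_{[d]}` correspond to invariants of `M`. -/
def homTrivialEquiv (M : Comod k A) :
    (E.trivial d ⟶ (E.filtration d).obj M) ≃ₗ[k] (zerothCohomology k A).obj M where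
  toFun φ := ⟨(E.subcoalgebra d).restrictInclusion M (φ.f.hom (1 : k)), E.invariant_of_hom d M φ⟩
  map_add' _ _ := rfl
  map_smul' _ _ := rfl
  invFun m := E.homOfInvariant d M m.1 m.2
  left_inv φ := by
    ext : 2
    apply LinearMap.ext_ring
    apply Subtype.ext
    exact one_smul k _
  right_inv m := by
    apply Subtype.ext
    exact one_smul k _

/-- The isomorphism `Hom(k, (-)_{[d]}) ≅ H^0(G, -)`. -/
def homTrivialIso : E.filtration d ⋙ E.homTrivial d ≅ zerothCohomology k A :=
  NatIso.ofComponents (fun M => (E.homTrivialEquiv d M).toModuleIso) fun _ => rfl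

end ExponentialStructure

end

end ExpFiltration

open CategoryTheory ExpFiltration in
theorem mainTheorem8 {k : Type u} [Field k] [IsAlgClosed k] (p : ℕ) [Fact p.Prime] [CharP k p]
    {A : Type u} [CommRing A] [HopfAlgebra k A] [Algebra.Smooth k A]
    [ConnectedSpace (PrimeSpectrum A)] (E : ExponentialStructure k p A) (d : ℕ) :
    (∃ e : E.filtration d ⋙ E.homTrivial d ≅ zerothCohomology k A,
      ∀ (M : Comod k A) (φ : E.trivial d ⟶ (E.filtration d).obj M),
        invariantsInclusion 1 M ((e.hom.app M).hom φ) =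
          (E.subcoalgebra d).restrictInclusion M (φ.f.hom (1 : k))) ∧
    ∀ M : Comod k A, ∃ S : E₂CohomologicalSpectralSequenceNat (ModuleCat.{u} k),
      (∀ s t : ℕ, Nonempty ((S.page 2).X (s, t) ≅
        ((E.homTrivial d).rightDerived s).obj (((E.filtration d).rightDerived t).obj M))) ∧
      ConvergesTo k S fun n => (cohomology k A n).obj M := by
  refine ⟨⟨E.homTrivialIso d, fun _ _ => rfl⟩, fun M => ?_⟩
  obtain ⟨S, hS, h⟩ := exists_grothendieckSpectralSequence (E.filtration d) (E.homTrivial d) M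
  -- The abutment is the derived functor of the composite, which the first part identifies with
  -- H^n(G, M).
  exact ⟨S, hS, h.of_iso fun n => (rightDerivedIso (E.homTrivialIso d) n).app M⟩
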